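/- Let $n\ge 1$ and write $[n]=\{1,2,\dots,n\}$ (with $[0]=\emptyset$). Let $\mathcal S_n$ be the set of permutations of $[n]$ and $\mathcal C_n\subseteq\mathcal S_n$ the set of $n$-cycles, that is, of permutations consisting of one single cycle of length $n$ (for $n=1$ the identity is the only one). For $\pi\in\mathcal S_n$ let $$D(\pi)=\{i : 1\le i\le n-1,\ \pi(i)>\pi(i+1)\}$$ be its descent set. Fix $1\le m\le n$ and let $J=[n-1]\setminus\{m-1,m\}$. Then for every $I\subseteq J$, $$|\{\pi\in\mathcal C_n : D(\pi)\cap J=I\}|=|\{\sigma\in\mathcal S_n : \sigma(m)=1,\ D(\sigma)\cap J=I\}|.$$ -/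

import Mathlib

/-- The set of cyclic permutations (`n`-cycles) of an `n`-element set: the permutations that consist
of one single cycle of length `n`, i.e. any two elements lie on the same cycle.
For `n = 1` the identity is a `1`-cycle. -/
def cyclicPerms (n : ℕ) : Set (Equiv.Perm (Fin n)) :=
  {π | π.IsCycleOn Set.univ}

/-- The descent set `D(π) = {i : 1 ≤ i ≤ n - 1, π(i) > π(i+1)}`, with positions numbered from `1`.
The element `j : Fin n` stands for `j + 1 ∈ {1, …, n}`, so that position `i` is the index `i - 1`
and position `i + 1` is the index `i`. -/
def descentSet {n : ℕ} (π : Equiv.Perm (Fin n)) : Finset ℕ :=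
  {i ∈ Finset.Icc 1 (n - 1) | ∃ a b : Fin n, (a : ℕ) + 1 = i ∧ (b : ℕ) = i ∧ π b < π a}

/-! By induction on `I` it suffices to count permutations with `D ∩ J ⊆ K`. Cut `[n]` after each
position in `K ∪ {m-1, m}`: the condition says that the permutation increases on every block, and
`{m}` is a block by itself. Let `f` send a position to its block and let `p` be position `m`. Both
sides are in bijection with the rearrangements of the word `f` that start with the letter `f p`: `σ`
gives `f ∘ σ⁻¹` (`bijOn_comp_symm`), and a cycle `π` gives the word `f (π^i p)`
(`bijOn_cycle_word`), decoded as in Gessel–Reutenauer by sorting cyclic shifts. As `f p` occurs only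
once, these shifts are distinct. -/

open Finset in
/-- If two statistics with values in finite sets have the same number of objects with value
contained in `K`, for each `K ⊆ J`, then they are equidistributed below `J`. -/
theorem card_filter_eq_of_card_filter_subset.{u, v} {α β : Type u} {γ : Type v} [DecidableEq γ]
    (A : Finset α) (B : Finset β) (g : α → Finset γ) (h : β → Finset γ) (J : Finset γ)
    (H : ∀ K ⊆ J, #{a ∈ A | g a ⊆ K} = #{b ∈ B | h b ⊆ K}) (I : Finset γ) (hI : I ⊆ J) :
    #{a ∈ A | g a = I} = #{b ∈ B | h b = I} := by
  induction I using Finset.strongInduction with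
  | H I ih =>
  have split : ∀ {δ : Type u} (C : Finset δ) (u : δ → Finset γ),
      #{a ∈ C | u a ⊆ I} = #{a ∈ C | u a = I} + ∑ K ∈ I.ssubsets, #{a ∈ C | u a = K} := by
    intro δ C u
    have hmaps : ∀ a ∈ C.filter (fun a => u a ⊆ I), u a ∈ I.powerset := by
      intro a ha
      exact mem_powerset.2 (mem_filter.1 ha).2
    rw [card_eq_sum_card_fiberwise hmaps, ssubsets,
      ← add_sum_erase _ _ (mem_powerset_self I)]
    congr 1
    · congr 1
      ext a
      simp only [mem_filter]
      constructor
      · rintro ⟨⟨h1, -⟩, h2⟩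
        exact ⟨h1, h2⟩
      · rintro ⟨h1, h2⟩
        exact ⟨⟨h1, h2.subset⟩, h2⟩
    · refine sum_congr rfl fun K hK => ?_
      have hKI : K ⊆ I := mem_powerset.1 (mem_of_mem_erase hK)
      congr 1
      ext a
      simp only [mem_filter]
      constructor
      · rintro ⟨⟨h1, -⟩, h2⟩
        exact ⟨h1, h2⟩
      · rintro ⟨h1, h2⟩
        exact ⟨⟨h1, h2 ▸ hKI⟩, h2⟩
  have hsum : ∑ K ∈ I.ssubsets, #{a ∈ A | g a = K} = ∑ K ∈ I.ssubsets, #{b ∈ B | h b = K} :=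
    sum_congr rfl fun K hK => ih K (mem_ssubsets.1 hK) ((mem_ssubsets.1 hK).subset.trans hI)
  have := H I hI
  rw [split A g, split B h, hsum] at this
  exact Nat.add_right_cancel this

/-! ### Words and their cyclic shifts -/

/-- The permutation `π` is increasing on each fiber of `f`. -/
def IncreasingOnFibers {n : ℕ} (f : Fin n → ℕ) (π : Equiv.Perm (Fin n)) : Prop :=
  ∀ a b, a < b → f a = f b → π a < π b

/-- The rearrangements of the word `f` that start with the letter `f p`. -/
def rearrangements {n : ℕ} (f : Fin (n + 1) → ℕ) (p : Fin (n + 1)) : Set (Fin (n + 1) → ℕ) :=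
  {w | w 0 = f p ∧ ∃ τ : Equiv.Perm (Fin (n + 1)), w = f ∘ τ}

/-- The cyclic shift of the word `w` starting at position `i`, ordered lexicographically. -/
def cyclicShift {n : ℕ} (w : Fin (n + 1) → ℕ) (i : Fin (n + 1)) : Lex (Fin (n + 1) → ℕ) :=
  toLex fun k => w (i + k)

section

variable {n : ℕ} {f : Fin (n + 1) → ℕ} {p : Fin (n + 1)}

theorem comp_eq_of_monotone_comp (hf : Monotone f) {w : Fin (n + 1) → ℕ}
    (hw : w ∈ rearrangements f p) {s : Equiv.Perm (Fin (n + 1))} (hs : Monotone (w ∘ s)) :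
    w ∘ s = f := by
  obtain ⟨-, τ, rfl⟩ := hw
  exact Tuple.unique_monotone (f := f) (σ := s.trans τ) (τ := Equiv.refl _) hs hf

theorem eq_zero_of_mem_rearrangements (hp : ∀ a, f a = f p → a = p) {w : Fin (n + 1) → ℕ}
    (hw : w ∈ rearrangements f p) {i : Fin (n + 1)} (hi : w i = w 0) : i = 0 := by
  obtain ⟨h0, τ, rfl⟩ := hw
  exact τ.injective ((hp _ (hi.trans h0)).trans (hp _ h0).symm)

/-- The inverse is stable sorting: increasing on fibers is exactly its tie-breaking rule. -/
theorem bijOn_comp_symm (hf : Monotone f) (hp : ∀ a, f a = f p → a = p) :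
    Set.BijOn (fun σ : Equiv.Perm (Fin (n + 1)) => f ∘ σ.symm)
      {σ | σ p = 0 ∧ IncreasingOnFibers f σ} (rearrangements f p) := by
  refine ⟨?_, ?_, ?_⟩
  · rintro σ ⟨h0, -⟩
    refine ⟨?_, σ.symm, rfl⟩
    simp [← h0]
  · have key : ∀ σ : Equiv.Perm (Fin (n + 1)), IncreasingOnFibers f σ →
        σ = Tuple.sort (f ∘ σ.symm) := by
      intro σ hσ
      rw [Tuple.eq_sort_iff]
      refine ⟨fun a b hab => by simpa using hf hab, fun a b hab h => hσ a b hab (by simpa using h)⟩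
    rintro σ ⟨-, hσ⟩ ρ ⟨-, hρ⟩ h
    rw [key σ hσ, key ρ hρ]
    exact congrArg Tuple.sort h
  · intro w hw
    have hs := comp_eq_of_monotone_comp hf hw (Tuple.monotone_sort w)
    have hs' : ∀ a, w (Tuple.sort w a) = f a := congrFun hs
    refine ⟨Tuple.sort w, ⟨?_, ?_⟩, ?_⟩
    · exact eq_zero_of_mem_rearrangements hp hw ((hs' p).trans hw.1.symm)
    · intro a b hab h
      refine ((Tuple.eq_sort_iff (f := w)).1 rfl).2 a b hab ?_
      rw [hs', hs', h]
    · ext i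
      simp [← hs']

theorem cyclicShift_injective (hp : ∀ a, f a = f p → a = p) {w : Fin (n + 1) → ℕ}
    (hw : w ∈ rearrangements f p) : Function.Injective (cyclicShift w) := by
  intro i j hij
  -- Entry `-i` of the shift at `i` is `w 0`, a letter with no other occurrence.
  have h : w (i + -i) = w (j + -i) := congrFun hij (-i)
  have := eq_zero_of_mem_rearrangements hp hw (i := j + -i) (by rw [← h]; simp)
  exact (add_neg_eq_zero.1 this).symm

theorem cyclicShift_zero_le {w : Fin (n + 1) → ℕ} {i j : Fin (n + 1)}
    (h : cyclicShift w i ≤ cyclicShift w j) : w i ≤ w j := by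
  rcases h.eq_or_lt with h | ⟨k, hk, hlt⟩
  · have := congrFun h 0
    simpa [cyclicShift] using (show w (i + 0) = w (j + 0) from this).le
  · rcases (Fin.zero_le k).eq_or_lt with rfl | h0
    · simpa using (show w (i + 0) < w (j + 0) from hlt).le
    · simpa using (show w (i + 0) = w (j + 0) from hk 0 h0).le

/-- Equal first letters put the first difference at some `k ≠ 0`; dropping them moves it to `k - 1`.
-/
theorem cyclicShift_add_one_lt {w : Fin (n + 1) → ℕ} {i j : Fin (n + 1)} (hij : w i = w j)
    (h : cyclicShift w i < cyclicShift w j) : cyclicShift w (i + 1) < cyclicShift w (j + 1) := by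
  obtain ⟨k, hk, hlt⟩ := h
  replace hk : ∀ l < k, w (i + l) = w (j + l) := hk
  replace hlt : w (i + k) < w (j + k) := hlt
  have hk0 : k ≠ 0 := by
    rintro rfl
    simp [hij] at hlt
  refine ⟨k - 1, fun l hl => ?_, ?_⟩
  · replace hl : l < k - 1 := hl
    have hl' : l + 1 < k := by
      rw [Fin.lt_def] at hl ⊢
      rw [Fin.val_sub_one_of_ne_zero hk0] at hl
      have := k.isLt
      rw [Fin.val_add_one_of_lt' (by omega)]
      omega
    change w (i + 1 + l) = w (j + 1 + l)
    rw [add_assoc, add_assoc, add_comm 1 l]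
    exact hk _ hl'
  · change w (i + 1 + (k - 1)) < w (j + 1 + (k - 1))
    rwa [add_assoc, add_assoc, add_sub_cancel]

theorem pow_conj_addRight_apply (s : Equiv.Perm (Fin (n + 1))) (k : ℕ) (a : Fin (n + 1)) :
    (((s.trans (Equiv.addRight 1)).trans s.symm : Equiv.Perm (Fin (n + 1))) ^ k) a =
      s.symm (s a + Fin.ofNat (n + 1) k) := by
  induction k with
  | zero => simp
  | succ k ih =>
    rw [pow_succ', Equiv.Perm.mul_apply, ih]
    simp only [Equiv.trans_apply, Equiv.apply_symm_apply, Equiv.coe_addRight, add_assoc]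
    congr 2
    ext
    simp [Fin.val_add]

theorem conj_addRight_mem_cyclicPerms (s : Equiv.Perm (Fin (n + 1))) :
    ((s.trans (Equiv.addRight 1)).trans s.symm : Equiv.Perm (Fin (n + 1))) ∈
      cyclicPerms (n + 1) := by
  refine ⟨Set.bijOn_univ.2 (Equiv.bijective _), fun a _ b _ => ⟨((s b - s a : Fin (n + 1)) : ℕ), ?_⟩⟩
  rw [zpow_natCast, pow_conj_addRight_apply]
  simp

/-! ### Cycles and words -/

/-- The elements of a cyclic permutation, in the order of the cycle starting at `p`. -/
noncomputable def cycleEnum (π : Equiv.Perm (Fin (n + 1))) (hπ : π ∈ cyclicPerms (n + 1))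
    (p : Fin (n + 1)) : Equiv.Perm (Fin (n + 1)) :=
  Equiv.ofBijective (fun i => (π ^ (i : ℕ)) p) (by
    refine Function.Surjective.bijective_of_finite fun b => ?_
    have hπ' : π.IsCycleOn (Finset.univ : Finset (Fin (n + 1))) := by
      rw [Finset.coe_univ]; exact hπ
    obtain ⟨k, hk, h⟩ := hπ'.exists_pow_eq (Finset.mem_univ p) (Finset.mem_univ b)
    exact ⟨⟨k, by simpa using hk⟩, h⟩)

theorem cycleEnum_apply (π : Equiv.Perm (Fin (n + 1))) (hπ : π ∈ cyclicPerms (n + 1))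
    (i : Fin (n + 1)) : cycleEnum π hπ p i = (π ^ (i : ℕ)) p := rfl

theorem cycleEnum_add (π : Equiv.Perm (Fin (n + 1))) (hπ : π ∈ cyclicPerms (n + 1))
    (i k : Fin (n + 1)) :
    cycleEnum π hπ p (i + k) = (π ^ (k : ℕ)) (cycleEnum π hπ p i) := by
  have hπ' : π.IsCycleOn (Finset.univ : Finset (Fin (n + 1))) := by
    rw [Finset.coe_univ]; exact hπ
  rw [cycleEnum_apply, cycleEnum_apply, ← Equiv.Perm.mul_apply, ← pow_add,
    hπ'.pow_apply_eq_pow_apply (Finset.mem_univ p), Fin.val_add, Finset.card_univ,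
    Fintype.card_fin, add_comm (k : ℕ)]
  exact Nat.mod_modEq _ _

theorem eq_conj_cycleEnum (π : Equiv.Perm (Fin (n + 1))) (hπ : π ∈ cyclicPerms (n + 1)) :
    π = ((cycleEnum π hπ p).symm.trans (Equiv.addRight 1)).trans (cycleEnum π hπ p) := by
  ext a
  congr 1
  obtain ⟨i, rfl⟩ := (cycleEnum π hπ p).surjective a
  have hπ' : π.IsCycleOn (Finset.univ : Finset (Fin (n + 1))) := by
    rw [Finset.coe_univ]; exact hπ
  have h := cycleEnum_add (p := p) π hπ i 1
  simp only [Equiv.trans_apply, Equiv.symm_apply_apply, Equiv.coe_addRight, h]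
  -- In `Fin 1` the exponent `1` has value `0`, so this case is separate.
  rcases n with _ | n
  · exact Subsingleton.elim (α := Fin 1) _ _
  · simp

theorem pow_lt_pow_of_increasingOnFibers {π : Equiv.Perm (Fin (n + 1))}
    (hπ : IncreasingOnFibers f π) {a b : Fin (n + 1)} (hab : a < b) (k : ℕ)
    (h : ∀ l < k, f ((π ^ l) a) = f ((π ^ l) b)) : (π ^ k) a < (π ^ k) b := by
  induction k with
  | zero => simpa
  | succ k ih =>
    rw [pow_succ', Equiv.Perm.mul_apply, Equiv.Perm.mul_apply]
    exact hπ _ _ (ih fun l hl => h l (by omega)) (h k (by omega))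

/-- For `a < b`, the iterates stay in order while their letters agree, so monotonicity of `f`
decides the first difference. Hence the word determines the cycle. -/
theorem cycleEnum_symm_eq_sort (hf : Monotone f) (hp : ∀ a, f a = f p → a = p)
    {π : Equiv.Perm (Fin (n + 1))} (hπ : π ∈ cyclicPerms (n + 1)) (hinc : IncreasingOnFibers f π) :
    (cycleEnum π hπ p).symm = Tuple.sort (cyclicShift (f ∘ cycleEnum π hπ p)) := by
  have hw : f ∘ cycleEnum π hπ p ∈ rearrangements f p :=
    ⟨by simp [cycleEnum_apply], cycleEnum π hπ p, rfl⟩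
  have happ : ∀ a k : Fin (n + 1),
      (f ∘ cycleEnum π hπ p) ((cycleEnum π hπ p).symm a + k) = f ((π ^ (k : ℕ)) a) := by
    intro a k
    rw [Function.comp_apply, cycleEnum_add, Equiv.apply_symm_apply]
  rw [Tuple.eq_sort_iff]
  constructor
  · rw [monotone_iff_forall_lt]
    intro a b hab
    by_contra hlt
    obtain ⟨k, hk, hlt⟩ := not_le.1 hlt
    replace hk : ∀ l < k, f ((π ^ (l : ℕ)) b) = f ((π ^ (l : ℕ)) a) := by
      intro l hl
      rw [← happ, ← happ]
      exact hk l hl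
    replace hlt : f ((π ^ (k : ℕ)) b) < f ((π ^ (k : ℕ)) a) := by
      rw [← happ, ← happ]
      exact hlt
    refine hlt.not_ge (hf (pow_lt_pow_of_increasingOnFibers hinc hab k fun l hl => ?_).le)
    exact (hk ⟨l, hl.trans k.isLt⟩ hl).symm
  · intro a b hab h
    exact absurd ((cycleEnum π hπ p).symm.injective (cyclicShift_injective hp hw h)) hab.ne

/-- A word is decoded by conjugating the rotation `i ↦ i + 1` with the permutation sorting its
shifts. -/
theorem bijOn_cycle_word (hf : Monotone f) (hp : ∀ a, f a = f p → a = p) :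
    Set.BijOn (fun (π : Equiv.Perm (Fin (n + 1))) (i : Fin (n + 1)) => f ((π ^ (i : ℕ)) p))
      {π | π ∈ cyclicPerms (n + 1) ∧ IncreasingOnFibers f π} (rearrangements f p) := by
  refine ⟨?_, ?_, ?_⟩
  · rintro π ⟨hπ, -⟩
    exact ⟨by simp, cycleEnum π hπ p, rfl⟩
  · rintro π ⟨hπ, hi⟩ ρ ⟨hρ, hj⟩ h
    have hsort : (cycleEnum π hπ p).symm = (cycleEnum ρ hρ p).symm := by
      rw [cycleEnum_symm_eq_sort hf hp hπ hi, cycleEnum_symm_eq_sort hf hp hρ hj]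
      exact congrArg (fun w => Tuple.sort (cyclicShift w)) h
    have hs : cycleEnum π hπ p = cycleEnum ρ hρ p := Equiv.symm_bijective.injective hsort
    rw [eq_conj_cycleEnum (p := p) π hπ, eq_conj_cycleEnum (p := p) ρ hρ, hs]
  · intro w hw
    obtain ⟨s, hs⟩ : ∃ s, s = Tuple.sort (cyclicShift w) := ⟨_, rfl⟩
    have hmono : Monotone (cyclicShift w ∘ s) := hs ▸ Tuple.monotone_sort _
    have hstrict : StrictMono (cyclicShift w ∘ s) :=
      hmono.strictMono_of_injective ((cyclicShift_injective hp hw).comp s.injective)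
    have hws : ∀ a, w (s a) = f a :=
      congrFun (comp_eq_of_monotone_comp hf hw fun a b hab =>
        cyclicShift_zero_le (i := s a) (j := s b) (hmono hab))
    have hsp : s p = 0 := eq_zero_of_mem_rearrangements hp hw ((hws p).trans hw.1.symm)
    refine ⟨(s.trans (Equiv.addRight 1)).trans s.symm,
      ⟨conj_addRight_mem_cyclicPerms s, fun a b hab h => ?_⟩, ?_⟩
    · rw [← hstrict.lt_iff_lt]
      have hlt := cyclicShift_add_one_lt (by rw [hws, hws, h]) (hstrict hab)
      change cyclicShift w (s (s.symm (s a + 1))) < cyclicShift w (s (s.symm (s b + 1)))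
      rw [Equiv.apply_symm_apply, Equiv.apply_symm_apply]
      exact hlt
    · ext i
      simp only [pow_conj_addRight_apply, hsp]
      simp [← hws]

theorem ncard_cyclicPerms_increasingOnFibers (hf : Monotone f) (hp : ∀ a, f a = f p → a = p) :
    Set.ncard {π | π ∈ cyclicPerms (n + 1) ∧ IncreasingOnFibers f π} =
      Set.ncard {σ : Equiv.Perm (Fin (n + 1)) | σ p = 0 ∧ IncreasingOnFibers f σ} := by
  rw [← (bijOn_cycle_word hf hp).injOn.ncard_image, (bijOn_cycle_word hf hp).image_eq,
    ← (bijOn_comp_symm hf hp).injOn.ncard_image, (bijOn_comp_symm hf hp).image_eq]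

end

/-! ### Descents and blocks -/

/-- The index of the block containing `a` when `Fin n` is cut before each element of `C`. -/
def blockIndex {n : ℕ} (C : Finset ℕ) (a : Fin n) : ℕ :=
  (C.filter (· ≤ (a : ℕ))).card

theorem blockIndex_monotone {n : ℕ} (C : Finset ℕ) : Monotone (blockIndex (n := n) C) :=
  fun _ _ hab => Finset.card_le_card fun _ hc =>
    Finset.mem_filter.2 ⟨(Finset.mem_filter.1 hc).1, (Finset.mem_filter.1 hc).2.trans hab⟩

theorem blockIndex_lt {n : ℕ} {C : Finset ℕ} {a b : Fin n} {c : ℕ} (hc : c ∈ C)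
    (hac : (a : ℕ) < c) (hcb : c ≤ b) : blockIndex C a < blockIndex C b := by
  refine Finset.card_lt_card (Finset.ssubset_iff_of_subset (fun d hd => ?_) |>.2 ⟨c, ?_, ?_⟩)
  · rw [Finset.mem_filter] at hd ⊢
    exact ⟨hd.1, by omega⟩
  · exact Finset.mem_filter.2 ⟨hc, hcb⟩
  · rw [Finset.mem_filter]
    omega

theorem blockIndex_eq_succ {n : ℕ} {C : Finset ℕ} {a b : Fin n} (hab : (a : ℕ) + 1 = b)
    (hb : (b : ℕ) ∉ C) : blockIndex C a = blockIndex C b := by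
  unfold blockIndex
  congr 1
  refine Finset.filter_congr fun c hc => ?_
  have : c ≠ b := fun h => hb (h ▸ hc)
  omega

theorem increasingOnFibers_blockIndex_iff {n : ℕ} (C : Finset ℕ) (π : Equiv.Perm (Fin n)) :
    IncreasingOnFibers (blockIndex C) π ↔ descentSet π ⊆ C := by
  constructor
  · intro h i hi
    obtain ⟨-, a, b, ha, hb, hlt⟩ := (Finset.mem_filter.1 hi)
    by_contra hiC
    refine (h a b (by rw [Fin.lt_def]; omega)
      (blockIndex_eq_succ (by omega) (by rwa [hb]))).not_gt hlt
  · intro h a b hab hf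
    obtain ⟨b, hb⟩ := b
    rw [Fin.lt_def] at hab
    change (a : ℕ) < b at hab
    induction b, hab using Nat.le_induction with
    | base =>
      by_contra hlt
      have hne : (⟨a + 1, hb⟩ : Fin n) ≠ a := fun h => by simpa using congrArg Fin.val h
      have hlt' := (not_lt.1 hlt).lt_of_ne (π.injective.ne hne)
      have : (a : ℕ) + 1 ∈ C := h (Finset.mem_filter.2
        ⟨Finset.mem_Icc.2 ⟨by omega, by omega⟩, a, _, rfl, rfl, hlt'⟩)
      exact (blockIndex_lt (a := a) (b := ⟨a + 1, hb⟩) this (by omega) le_rfl).ne hf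
    | succ b hab ih =>
      have hb' : b < n := by omega
      have h1 : blockIndex C a ≤ blockIndex C (⟨b, hb'⟩ : Fin n) :=
        blockIndex_monotone C (by rw [Fin.le_def]; exact (Nat.lt_of_succ_le hab).le)
      have h2 : blockIndex C (⟨b, hb'⟩ : Fin n) ≤ blockIndex C (⟨b + 1, hb⟩ : Fin n) :=
        blockIndex_monotone C (by rw [Fin.le_def]; exact Nat.le_succ b)
      refine (ih hb' (by omega)).trans ?_
      by_contra hlt
      have hne : (⟨b + 1, hb⟩ : Fin n) ≠ ⟨b, hb'⟩ := fun h => by simpa using congrArg Fin.val h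
      have hlt' := (not_lt.1 hlt).lt_of_ne (π.injective.ne hne)
      have : b + 1 ∈ C := h (Finset.mem_filter.2
        ⟨Finset.mem_Icc.2 ⟨by omega, by omega⟩, ⟨b, hb'⟩, _, rfl, rfl, hlt'⟩)
      have := blockIndex_lt (a := ⟨b, hb'⟩) (b := ⟨b + 1, hb⟩) this (by simp) le_rfl
      omega

theorem corollary4 (n m : ℕ) (hm : 1 ≤ m) (hmn : m ≤ n) (J : Finset ℕ)
    (hJ : J = Finset.Icc 1 (n - 1) \ {m - 1, m}) (I : Finset ℕ) (hI : I ⊆ J) :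
    Set.ncard {π : Equiv.Perm (Fin n) | π ∈ cyclicPerms n ∧ descentSet π ∩ J = I} =
      Set.ncard {σ : Equiv.Perm (Fin n) |
        σ ⟨m - 1, by omega⟩ = ⟨0, by omega⟩ ∧ descentSet σ ∩ J = I} := by
  classical
  obtain ⟨n, rfl⟩ : ∃ k, n = k + 1 := ⟨n - 1, by omega⟩
  have hcard : ∀ P : Equiv.Perm (Fin (n + 1)) → Prop,
      Set.ncard {x | P x} = (Finset.univ.filter P).card := fun P => by
    rw [← Set.ncard_coe_finset, Finset.coe_filter_univ]
  have hsub : ∀ K ⊆ J, ∀ π : Equiv.Perm (Fin (n + 1)),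
      IncreasingOnFibers (blockIndex (K ∪ {m - 1, m})) π ↔ descentSet π ∩ J ⊆ K := by
    intro K _ π
    rw [increasingOnFibers_blockIndex_iff]
    have hD : descentSet π ⊆ Finset.Icc 1 (n + 1 - 1) := Finset.filter_subset _ _
    constructor
    · intro h i hi
      rw [Finset.mem_inter] at hi
      have h1 := h hi.1
      have h2 := hi.2
      rw [hJ, Finset.mem_sdiff] at h2
      exact (Finset.mem_union.1 h1).resolve_right h2.2
    · intro h i hi
      by_cases hc : i ∈ ({m - 1, m} : Finset ℕ)
      · exact Finset.mem_union_right _ hc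
      · refine Finset.mem_union_left _ (h (Finset.mem_inter.2 ⟨hi, ?_⟩))
        rw [hJ]
        exact Finset.mem_sdiff.2 ⟨hD hi, hc⟩
  have hfib : ∀ (K : Finset ℕ) (a : Fin (n + 1)), blockIndex (K ∪ {m - 1, m}) a =
      blockIndex (K ∪ {m - 1, m}) (⟨m - 1, by omega⟩ : Fin (n + 1)) → a = ⟨m - 1, by omega⟩ := by
    intro K a h
    -- The cuts before indices `m - 1` and `m` isolate index `m - 1`; a cut at `0` or `n` separates
    -- nothing.
    rcases lt_trichotomy (a : ℕ) (m - 1) with hlt | heq | hgt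
    · exact absurd h (blockIndex_lt (c := m - 1) (by simp) hlt le_rfl).ne
    · exact Fin.ext heq
    · exact absurd h (blockIndex_lt (c := m) (by simp)
        (show m - 1 < m by omega) (show m ≤ (a : ℕ) by omega)).ne'
  have key := card_filter_eq_of_card_filter_subset
    (Finset.univ.filter fun π : Equiv.Perm (Fin (n + 1)) => π ∈ cyclicPerms (n + 1))
    (Finset.univ.filter fun σ : Equiv.Perm (Fin (n + 1)) => σ ⟨m - 1, by omega⟩ = ⟨0, by omega⟩)
    (fun π => descentSet π ∩ J) (fun σ => descentSet σ ∩ J) J (fun K hK => by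
      have := ncard_cyclicPerms_increasingOnFibers
        (blockIndex_monotone (n := n + 1) (K ∪ {m - 1, m})) (hfib K)
      simp only [hsub K hK] at this
      rw [hcard, hcard] at this
      rw [Finset.filter_filter, Finset.filter_filter]
      convert this
      rfl) I hI
  rw [Finset.filter_filter, Finset.filter_filter] at key
  rw [hcard, hcard]
  convert key
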